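/- Let $A\in\mathbb{C}^{n\times n}$, $B\in\mathbb{C}^{n\times m}$ with $(A,B)$ controllable, i.e. $\operatorname{rank}[B\ AB\ \cdots\ A^{n-1}B]=n$, and let $V,Q\in\mathbb{C}^{n\times n}$ and $R\in\mathbb{C}^{m\times m}$ be Hermitian positive definite. Put $\mathcal{A}_1(X)=AX+XA^*$ for $X\in\mathbb{C}^{n\times n}$ and $\mathcal{B}(Y)=BY+Y^*B^*$ for $Y\in\mathbb{C}^{m\times n}$, and assume that the linear operator $\mathcal{A}_1$ is invertible. Define $$X(Y)=\mathcal{A}_1^{-1}(\mathcal{B}(Y)-V),\qquad \mathcal{D}_s=\{Y\in\mathbb{C}^{m\times n} : \mathcal{A}_1(X(Y))-\mathcal{B}(Y)=-V,\ X(Y)\succ 0\},$$ $$f(Y)=\operatorname{tr}\bigl(Q\,X(Y)+Y^*R\,Y\,X(Y)^{-1}\bigr),\qquad Y\in\mathcal{D}_s .$$ Regard $\mathbb{C}^{m\times n}$ as a real inner product space with $\langle Y,Z\rangle=\operatorname{Re}\operatorname{tr}(Y^*Z)$, whose norm is the Frobenius norm; gradients, Lipschitz constants and strong convexity moduli refer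 to it. Then $f$ is real-valued on $\mathcal{D}_s$, the set $\mathcal{D}_s$ is open and convex, and $f$ (extended by $+\infty$ outside $\mathcal{D}_s$) is a proper closed convex function, that is, $\mathcal{D}_s\neq\emptyset$, the epigraph $\{(Y,t) : Y\in\mathcal{D}_s,\ f(Y)\le t\}$ is closed, and $f$ is convex on $\mathcal{D}_s$. Moreover, for every $a\in\mathbb{R}$, with $\mathcal{D}(a)=\{Y\in\mathcal{D}_s : f(Y)\le a\}$: (i) $\mathcal{D}(a)$ is compact; (ii) $f$ is differentiable at every point of $\mathcal{D}(a)$, and there is $L_a>0$ such that $\|\nabla f(Y)-\nabla f(Y')\|_F\le L_a\|Y-Y'\|_F$ for all $Y,Y'\in\mathcal{D}(a)$; (iii) there is $\mu_a>0$ such that $f$ is strongly convex with modulus $\mu_a$ on $\mathcal{D}(a)$, that is, $\mathcal{D}(a)$ is convex and $f(sY+tY')\le s f(Y)+t f(Y')-\tfrac{\mu_a}{2}\,s\,t\,\|Y-Y'\|_F^2$ for all $Y,Y'\in\mathcal{D}(a)$ and $s,t\ge 0$ with $s+t=1$. -/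

import Mathlib

open Matrix
open scoped ComplexOrder Gradient

attribute [local instance] Matrix.frobeniusNormedAddCommGroup Matrix.frobeniusNormedSpace

/-- The real inner product `⟪Y, Z⟫ = Re tr(Y* Z)` on complex matrices. Its norm is the Frobenius
norm. Gradients of real functions of a complex matrix are taken with respect to it. -/
@[reducible] noncomputable def frobeniusRealInner (k l : ℕ) :
    InnerProductSpace ℝ (Matrix (Fin k) (Fin l) ℂ) where
  toNormedSpace := Matrix.frobeniusNormedSpace
  inner Y Z := (trace (Yᴴ * Z)).re
  norm_sq_eq_re_inner Y := by
    have h0 : (0 : ℝ) ≤ ∑ i, ∑ j, ‖Y i j‖ ^ (2 : ℝ) :=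
      Finset.sum_nonneg fun i _ => Finset.sum_nonneg fun j _ => by positivity
    rw [Matrix.frobenius_norm_def, ← Real.sqrt_eq_rpow, Real.sq_sqrt h0, Finset.sum_comm]
    simp [Matrix.trace, Matrix.mul_apply, ← Complex.normSq_eq_norm_sq, Complex.normSq_apply]
  conj_inner_symm Y Z := by
    have h : trace (Zᴴ * Y) = star (trace (Yᴴ * Z)) := by
      rw [← Matrix.trace_conjTranspose, Matrix.conjTranspose_mul,
        Matrix.conjTranspose_conjTranspose]
    simp [h]
  add_left Y Z W := by
    simp [Matrix.add_mul]
  smul_left Y Z r := by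
    simp [Matrix.trace, Matrix.mul_apply, Finset.mul_sum, mul_add]

attribute [local instance] frobeniusRealInner

/-- The controllability matrix `[B, AB, …, Aⁿ⁻¹B]`. -/
noncomputable def controllabilityMatrix {n m : ℕ} (A : Matrix (Fin n) (Fin n) ℂ)
    (B : Matrix (Fin n) (Fin m) ℂ) : Matrix (Fin n) (Fin n × Fin m) ℂ :=
  Matrix.of fun i kj => (A ^ (kj.1 : ℕ) * B) i kj.2

/-- Controllability of the pair `(A, B)` (Kalman rank condition). -/
def IsControllable {n m : ℕ} (A : Matrix (Fin n) (Fin n) ℂ)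
    (B : Matrix (Fin n) (Fin m) ℂ) : Prop :=
  (controllabilityMatrix A B).rank = n

/-- The Lyapunov operator `X ↦ A X + X A*`. -/
noncomputable def lyapunovOp {n : ℕ} (A : Matrix (Fin n) (Fin n) ℂ) :
    Module.End ℂ (Matrix (Fin n) (Fin n) ℂ) where
  toFun X := A * X + X * Aᴴ
  map_add' X Z := by
    rw [Matrix.mul_add, Matrix.add_mul]; abel
  map_smul' c X := by
    simp [smul_add]

/-- The input operator `Y ↦ B Y + Y* B*`. -/
noncomputable def inputOp {n m : ℕ} (B : Matrix (Fin n) (Fin m) ℂ)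
    (Y : Matrix (Fin m) (Fin n) ℂ) : Matrix (Fin n) (Fin n) ℂ :=
  B * Y + Yᴴ * Bᴴ

/-- `X(Y)`: the inverse Lyapunov operator applied to `B Y + Y* B* - V`. The value of
`Ring.inverse` is the actual inverse whenever the operator is invertible. -/
noncomputable def covarianceOf {n m : ℕ} (A : Matrix (Fin n) (Fin n) ℂ)
    (B : Matrix (Fin n) (Fin m) ℂ) (V : Matrix (Fin n) (Fin n) ℂ)
    (Y : Matrix (Fin m) (Fin n) ℂ) : Matrix (Fin n) (Fin n) ℂ :=
  Ring.inverse (lyapunovOp A) (inputOp B Y - V)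

/-- The domain of those `Y` for which `X(Y)` solves the Lyapunov equation and is positive
definite. -/
def stabilizingSet {n m : ℕ} (A : Matrix (Fin n) (Fin n) ℂ) (B : Matrix (Fin n) (Fin m) ℂ)
    (V : Matrix (Fin n) (Fin n) ℂ) : Set (Matrix (Fin m) (Fin n) ℂ) :=
  {Y | lyapunovOp A (covarianceOf A B V Y) - inputOp B Y = -V ∧ (covarianceOf A B V Y).PosDef}

/-- `tr(Q X(Y) + Y* R Y X(Y)⁻¹)`, as a complex number. -/
noncomputable def lqrTrace {n m : ℕ} (A : Matrix (Fin n) (Fin n) ℂ)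
    (B : Matrix (Fin n) (Fin m) ℂ) (V Q : Matrix (Fin n) (Fin n) ℂ)
    (R : Matrix (Fin m) (Fin m) ℂ) (Y : Matrix (Fin m) (Fin n) ℂ) : ℂ :=
  trace (Q * covarianceOf A B V Y + Yᴴ * R * Y * (covarianceOf A B V Y)⁻¹)

/-- The cost `f(Y) = tr(Q X(Y) + Y* R Y X(Y)⁻¹)`, as a real number. -/
noncomputable def lqrCost {n m : ℕ} (A : Matrix (Fin n) (Fin n) ℂ)
    (B : Matrix (Fin n) (Fin m) ℂ) (V Q : Matrix (Fin n) (Fin n) ℂ)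
    (R : Matrix (Fin m) (Fin m) ℂ) (Y : Matrix (Fin m) (Fin n) ℂ) : ℝ :=
  (lqrTrace A B V Q R Y).re

/-- The sublevel set `{Y ∈ D | f(Y) ≤ a}`. -/
def sublevelSet {E : Type*} (D : Set E) (f : E → ℝ) (a : ℝ) : Set E :=
  {Y | Y ∈ D ∧ f Y ≤ a}

/-- `f`, regarded as an extended-valued function that equals `+∞` outside `D`, is proper, closed and
convex, its domain `D` is open and convex, and on every sublevel set it has the three listed
properties. Only the values of `f` on `D` matter, since `D` is open. -/
structure SublevelRegular {E : Type*} [NormedAddCommGroup E] [InnerProductSpace ℝ E]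
    [CompleteSpace E] (D : Set E) (f : E → ℝ) : Prop where
  isOpen_domain : IsOpen D
  convex_domain : Convex ℝ D
  proper : D.Nonempty
  closed : IsClosed {p : E × ℝ | p.1 ∈ D ∧ f p.1 ≤ p.2}
  convex : ConvexOn ℝ D f
  compact_sublevel : ∀ a : ℝ, IsCompact (sublevelSet D f a)
  lipschitz_gradient : ∀ a : ℝ, (∀ Y ∈ sublevelSet D f a, DifferentiableAt ℝ f Y) ∧
    ∃ L : NNReal, 0 < L ∧ LipschitzOnWith L (∇ f) (sublevelSet D f a)
  strong_convexity : ∀ a : ℝ, ∃ μ : ℝ, 0 < μ ∧ StrongConvexOn (sublevelSet D f a) μ f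

/-! ### Positive semidefinite matrices and the Frobenius norm -/

section PositiveSemidefinite

variable {k l n : ℕ}

/-! `X(Y)` is affine in `Y` and the Lyapunov equation holds automatically, so the domain is the
preimage of the positive definite cone: open and convex. It is nonempty because a controllable pair
is stabilizable: Bass' construction gives a gain `K` and a `W ≻ 0` certifying that `A - B K` is
stable, and the closed-loop Lyapunov equation then has a solution `X ≻ 0`, giving the point `Y = K
X`. Stability is never expressed through eigenvalues: a strict Lyapunov certificate gives
positivity, invertibility and norm bounds (`posSemidef_of_neg_lyapunovOp`,
`norm_le_of_lyapunov_certificate`).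

The cost is linear in `X` plus `tr(R Y X⁻¹ Y*)`, a matrix fractional function. On a sublevel set, `Q
≻ 0` and `R ≻ 0` bound `tr X` and `tr(Y X⁻¹ Y*)`; testing the Lyapunov equation on vectors, with `V
≻ 0`, then forces `X ≥ δ I` (`covarianceOf_sub_smul_one_posSemidef`). Hence the sublevel set stays
away from the boundary of the domain and is compact, and since `f` is smooth there its gradient is
Lipschitz.

For strong convexity, completing the square (`matrix_fractional_defect`) writes the convexity defect
through the gains `K = Y X⁻¹`, bounding it below by a multiple of `s t ‖K_Y - K_W‖²`. A closed-loop
Lyapunov estimate (`norm_sub_le_mul_norm_gain_sub`) bounds `‖Y - W‖` by a multiple of this gain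
difference. -/

lemma frobenius_norm_sq (Y : Matrix (Fin k) (Fin l) ℂ) : ‖Y‖ ^ 2 = (trace (Yᴴ * Y)).re :=
  (frobeniusRealInner k l).norm_sq_eq_re_inner Y

lemma re_trace_conjTranspose_mul_le (Y Z : Matrix (Fin k) (Fin l) ℂ) :
    (trace (Yᴴ * Z)).re ≤ ‖Y‖ * ‖Z‖ :=
  real_inner_le_norm Y Z

lemma conjTranspose_real_smul (c : ℝ) (Y : Matrix (Fin k) (Fin l) ℂ) : (c • Y)ᴴ = c • Yᴴ := by
  rw [conjTranspose_smul, star_trivial]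

lemma re_trace_real_smul (c : ℝ) (Y : Matrix (Fin k) (Fin k) ℂ) :
    (trace (c • Y)).re = c * (trace Y).re := by
  rw [trace_smul, Complex.smul_re, smul_eq_mul]

lemma Matrix.PosSemidef.exists_conjTranspose_mul_self {M : Matrix (Fin n) (Fin n) ℂ}
    (hM : M.PosSemidef) : ∃ C : Matrix (Fin n) (Fin n) ℂ, M = Cᴴ * C := by
  open scoped MatrixOrder in
  exact CStarAlgebra.nonneg_iff_eq_star_mul_self.mp hM.nonneg

lemma Matrix.PosSemidef.re_trace_nonneg {M : Matrix (Fin n) (Fin n) ℂ} (hM : M.PosSemidef) :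
    0 ≤ (trace M).re :=
  (Complex.le_def.mp hM.trace_nonneg).1

lemma Matrix.PosSemidef.re_trace_mul_nonneg {M N : Matrix (Fin n) (Fin n) ℂ} (hM : M.PosSemidef)
    (hN : N.PosSemidef) : 0 ≤ (trace (M * N)).re := by
  obtain ⟨C, rfl⟩ := hN.exists_conjTranspose_mul_self
  rw [← Matrix.mul_assoc, trace_mul_comm, ← Matrix.mul_assoc]
  exact (hM.mul_mul_conjTranspose_same C).re_trace_nonneg

/-- Vectors are treated as one-column matrices, so that the Frobenius norm and its Cauchy-Schwarz
inequality apply to them directly. -/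
lemma trace_quadratic_replicateCol (M : Matrix (Fin n) (Fin n) ℂ) (x : Fin n → ℂ) :
    trace ((replicateCol (Fin 1) x)ᴴ * M * replicateCol (Fin 1) x) = star x ⬝ᵥ M *ᵥ x := by
  rw [Matrix.mul_assoc]
  simp [trace, Matrix.mul_apply, dotProduct, mulVec]

lemma Matrix.IsHermitian.im_quadratic {M : Matrix (Fin n) (Fin n) ℂ} (hM : M.IsHermitian)
    (W : Matrix (Fin n) (Fin k) ℂ) : (trace (Wᴴ * M * W)).im = 0 := by
  have h : star (trace (Wᴴ * M * W)) = trace (Wᴴ * M * W) := by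
    rw [← trace_conjTranspose]
    simp [Matrix.mul_assoc, hM.eq]
  exact Complex.conj_eq_iff_im.mp h

lemma Matrix.IsHermitian.posSemidef_of_re {M : Matrix (Fin n) (Fin n) ℂ} (hM : M.IsHermitian)
    (h : ∀ v : Matrix (Fin n) (Fin 1) ℂ, 0 ≤ (trace (vᴴ * M * v)).re) : M.PosSemidef := by
  refine .of_dotProduct_mulVec_nonneg hM fun x => ?_
  rw [← trace_quadratic_replicateCol]
  exact Complex.le_def.mpr ⟨h _, (hM.im_quadratic _).symm⟩

lemma Matrix.IsHermitian.posDef_of_re {M : Matrix (Fin n) (Fin n) ℂ} (hM : M.IsHermitian)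
    (h : ∀ v : Matrix (Fin n) (Fin 1) ℂ, v ≠ 0 → 0 < (trace (vᴴ * M * v)).re) : M.PosDef := by
  refine .of_dotProduct_mulVec_pos hM fun x hx => ?_
  rw [← trace_quadratic_replicateCol]
  refine Complex.lt_def.mpr ⟨h _ fun h0 => hx ?_, (hM.im_quadratic _).symm⟩
  ext i
  simpa using congrFun (congrFun h0 i) 0

lemma Matrix.PosSemidef.re_quadratic_nonneg {M : Matrix (Fin n) (Fin n) ℂ} (hM : M.PosSemidef)
    (W : Matrix (Fin n) (Fin k) ℂ) : 0 ≤ (trace (Wᴴ * M * W)).re :=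
  (hM.conjTranspose_mul_mul_same W).re_trace_nonneg

lemma Matrix.PosSemidef.mul_eq_zero_of_re_quadratic {M : Matrix (Fin n) (Fin n) ℂ}
    (hM : M.PosSemidef) {W : Matrix (Fin n) (Fin k) ℂ} (h : (trace (Wᴴ * M * W)).re ≤ 0) :
    M * W = 0 := by
  obtain ⟨C, rfl⟩ := hM.exists_conjTranspose_mul_self
  have h1 : ‖C * W‖ ^ 2 = (trace (Wᴴ * (Cᴴ * C) * W)).re := by
    rw [frobenius_norm_sq, conjTranspose_mul]
    simp only [Matrix.mul_assoc]
  have h2 : C * W = 0 := by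
    rw [← norm_eq_zero, ← sq_eq_zero_iff]
    exact le_antisymm (h1 ▸ h) (sq_nonneg _)
  rw [Matrix.mul_assoc, h2, Matrix.mul_zero]

lemma Matrix.PosDef.re_quadratic_pos {M : Matrix (Fin n) (Fin n) ℂ}
    (hM : M.PosDef) {W : Matrix (Fin n) (Fin k) ℂ} (hW : W ≠ 0) :
    0 < (trace (Wᴴ * M * W)).re := by
  by_contra! h
  have h1 := hM.posSemidef.mul_eq_zero_of_re_quadratic h
  apply hW
  have hu := (Matrix.isUnit_iff_isUnit_det M).mp hM.isUnit
  rw [← Matrix.nonsing_inv_mul_cancel_left M W hu, h1, Matrix.mul_zero]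

lemma Matrix.PosSemidef.posDef_of_mul_eq_zero {M : Matrix (Fin n) (Fin n) ℂ} (hM : M.PosSemidef)
    (h : ∀ v : Matrix (Fin n) (Fin 1) ℂ, M * v = 0 → v = 0) : M.PosDef := by
  refine hM.1.posDef_of_re fun v hv => ?_
  by_contra! h1
  exact hv (h v (hM.mul_eq_zero_of_re_quadratic h1))

lemma re_quadratic_sub_smul_one (M : Matrix (Fin n) (Fin n) ℂ) (c : ℝ)
    (W : Matrix (Fin n) (Fin k) ℂ) :
    (trace (Wᴴ * (M - c • 1) * W)).re = (trace (Wᴴ * M * W)).re - c * ‖W‖ ^ 2 := by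
  rw [frobenius_norm_sq, Matrix.mul_sub, Matrix.sub_mul, trace_sub, Complex.sub_re,
    Matrix.mul_smul, Matrix.smul_mul, re_trace_real_smul, Matrix.mul_one]

lemma Matrix.IsHermitian.real_smul {M : Matrix (Fin n) (Fin n) ℂ} (hM : M.IsHermitian) (c : ℝ) :
    (c • M).IsHermitian := by
  rw [IsHermitian, conjTranspose_real_smul, hM.eq]

lemma Matrix.PosSemidef.real_smul {M : Matrix (Fin n) (Fin n) ℂ} (hM : M.PosSemidef) {c : ℝ}
    (hc : 0 ≤ c) : (c • M).PosSemidef := by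
  refine (hM.1.real_smul c).posSemidef_of_re fun v => ?_
  rw [Matrix.mul_smul, Matrix.smul_mul, re_trace_real_smul]
  exact mul_nonneg hc (hM.re_quadratic_nonneg v)

lemma Matrix.PosDef.real_smul {M : Matrix (Fin n) (Fin n) ℂ} (hM : M.PosDef) {c : ℝ}
    (hc : 0 < c) : (c • M).PosDef := by
  refine (hM.1.real_smul c).posDef_of_re fun v hv => ?_
  rw [Matrix.mul_smul, Matrix.smul_mul, re_trace_real_smul]
  exact mul_pos hc (hM.re_quadratic_pos hv)

/-- Cauchy-Schwarz and submultiplicativity bound `v* M v` by `‖M‖ ‖v‖²`; this stands in for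
eigenvalue bounds throughout. -/
lemma Matrix.IsHermitian.norm_smul_one_sub_posSemidef {M : Matrix (Fin n) (Fin n) ℂ}
    (hM : M.IsHermitian) : (‖M‖ • 1 - M).PosSemidef := by
  refine ((isHermitian_one.real_smul _).sub hM).posSemidef_of_re fun v => ?_
  have h1 := re_quadratic_sub_smul_one M ‖M‖ v
  have h2 : (trace (vᴴ * (‖M‖ • 1 - M) * v)).re = -(trace (vᴴ * (M - ‖M‖ • 1) * v)).re := by
    rw [← neg_sub M, Matrix.mul_neg, Matrix.neg_mul, trace_neg, Complex.neg_re]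
  have h3 := re_trace_conjTranspose_mul_le v (M * v)
  rw [← Matrix.mul_assoc] at h3
  have h4 := mul_le_mul_of_nonneg_left (frobenius_norm_mul M v) (norm_nonneg v)
  rw [h2, h1]
  nlinarith

lemma Matrix.PosDef.exists_sub_smul_one_posSemidef {M : Matrix (Fin n) (Fin n) ℂ}
    (hM : M.PosDef) : ∃ ε : ℝ, 0 < ε ∧ (M - ε • 1).PosSemidef := by
  obtain ⟨C, hC⟩ := hM.posSemidef.exists_conjTranspose_mul_self
  have hCu : IsUnit C.det := by
    have h := (Matrix.isUnit_iff_isUnit_det M).mp hM.isUnit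
    rw [hC, det_mul] at h
    exact isUnit_of_mul_isUnit_right h
  -- With `M = C* C`, `‖v‖ ≤ ‖C⁻¹‖ ‖C v‖` makes `1 / ‖C⁻¹‖²` a lower bound for `M`; adding 1 also
  -- covers `n = 0`, where the norm vanishes.
  have hpos : 0 < ‖C⁻¹‖ ^ 2 + 1 := by positivity
  refine ⟨(‖C⁻¹‖ ^ 2 + 1)⁻¹, inv_pos.mpr hpos,
    (hM.1.sub (isHermitian_one.real_smul _)).posSemidef_of_re fun v => ?_⟩
  have h1 : ‖C * v‖ ^ 2 = (trace (vᴴ * M * v)).re := by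
    rw [frobenius_norm_sq, conjTranspose_mul, hC]
    simp only [Matrix.mul_assoc]
  have h2 : ‖v‖ ≤ ‖C⁻¹‖ * ‖C * v‖ := by
    conv_lhs => rw [← Matrix.nonsing_inv_mul_cancel_left C v hCu]
    exact frobenius_norm_mul _ _
  rw [re_quadratic_sub_smul_one, ← h1, sub_nonneg, inv_mul_le_iff₀ hpos]
  have h3 : ‖v‖ ^ 2 ≤ (‖C⁻¹‖ * ‖C * v‖) ^ 2 := by gcongr
  nlinarith [sq_nonneg ‖C * v‖]

lemma Matrix.PosSemidef.posDef_of_sub_smul_one {M : Matrix (Fin n) (Fin n) ℂ} {ε : ℝ} (hε : 0 < ε)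
    (hM : (M - ε • 1).PosSemidef) : M.PosDef := by
  have := (PosDef.one (n := Fin n) (R := ℂ)).real_smul hε |>.add_posSemidef hM
  simpa using this

lemma Matrix.PosSemidef.norm_le_re_trace {M : Matrix (Fin n) (Fin n) ℂ} (hM : M.PosSemidef) :
    ‖M‖ ≤ (trace M).re := by
  obtain ⟨C, rfl⟩ := hM.exists_conjTranspose_mul_self
  rw [← frobenius_norm_sq, sq]
  exact (frobenius_norm_mul _ _).trans_eq (by rw [frobenius_norm_conjTranspose])

lemma mul_re_trace_le_re_trace_mul {M P : Matrix (Fin n) (Fin n) ℂ} {ε : ℝ}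
    (hM : (M - ε • 1).PosSemidef) (hP : P.PosSemidef) :
    ε * (trace P).re ≤ (trace (M * P)).re := by
  have h := hM.re_trace_mul_nonneg hP
  rw [Matrix.sub_mul, trace_sub, Complex.sub_re, Matrix.smul_mul, re_trace_real_smul,
    Matrix.one_mul] at h
  linarith

lemma isClosed_posSemidef : IsClosed {M : Matrix (Fin n) (Fin n) ℂ | M.PosSemidef} := by
  have h : {M : Matrix (Fin n) (Fin n) ℂ | M.PosSemidef} =
      {M | Mᴴ = M} ∩ ⋂ v : Matrix (Fin n) (Fin 1) ℂ, {M | 0 ≤ (trace (vᴴ * M * v)).re} := by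
    ext M
    simp only [Set.mem_ofPred_eq, Set.mem_inter_iff, Set.mem_iInter]
    exact ⟨fun h => ⟨h.1, h.re_quadratic_nonneg⟩, fun h => IsHermitian.posSemidef_of_re h.1 h.2⟩
  rw [h]
  refine (isClosed_eq ?_ continuous_id).inter (isClosed_iInter fun v => isClosed_le ?_ ?_)
  · exact Continuous.matrix_conjTranspose continuous_id
  · exact continuous_const
  · exact Complex.continuous_re.comp (Continuous.matrix_trace
      ((continuous_const.matrix_mul continuous_id).matrix_mul continuous_const))

end PositiveSemidefinite

/-! ### Lyapunov certificates and stabilizability -/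

section Lyapunov

variable {n m : ℕ}

lemma lyapunovOp_apply (A X : Matrix (Fin n) (Fin n) ℂ) :
    lyapunovOp A X = A * X + X * Aᴴ := rfl

lemma lyapunovOp_real_smul (A X : Matrix (Fin n) (Fin n) ℂ) (c : ℝ) :
    lyapunovOp A (c • X) = c • lyapunovOp A X := by
  simp [lyapunovOp_apply]

lemma lyapunovOp_conjTranspose (A X : Matrix (Fin n) (Fin n) ℂ) :
    lyapunovOp A Xᴴ = (lyapunovOp A X)ᴴ := by
  simp [lyapunovOp_apply, add_comm]

lemma lyapunovOp_isHermitian {A X : Matrix (Fin n) (Fin n) ℂ} (hX : X.IsHermitian) :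
    (lyapunovOp A X).IsHermitian := by
  rw [IsHermitian, ← lyapunovOp_conjTranspose, hX.eq]

lemma quadratic_lyapunovOp_eq_zero {A X : Matrix (Fin n) (Fin n) ℂ} (hX : X.IsHermitian)
    {v : Matrix (Fin n) (Fin 1) ℂ} (hv : X * v = 0) : vᴴ * lyapunovOp A X * v = 0 := by
  have h : vᴴ * X = 0 := by
    rw [← conjTranspose_eq_zero, conjTranspose_mul, hX.eq, conjTranspose_conjTranspose, hv]
  rw [lyapunovOp_apply, Matrix.mul_add, Matrix.add_mul, ← Matrix.mul_assoc vᴴ X, h,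
    Matrix.zero_mul, Matrix.zero_mul, add_zero, Matrix.mul_assoc, Matrix.mul_assoc, hv,
    Matrix.mul_zero, Matrix.mul_zero]

/-- A positive semidefinite solution of a strict Lyapunov inequality is positive definite. -/
lemma Matrix.PosSemidef.posDef_of_lyapunovOp {A X : Matrix (Fin n) (Fin n) ℂ} (hX : X.PosSemidef)
    (h : (-lyapunovOp A X).PosDef) : X.PosDef := by
  refine hX.posDef_of_mul_eq_zero fun v hv => ?_
  by_contra hv0
  have h1 := h.re_quadratic_pos hv0
  rw [Matrix.mul_neg, Matrix.neg_mul, quadratic_lyapunovOp_eq_zero hX.1 hv] at h1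
  simp at h1

/-- If `A` admits a strict Lyapunov certificate `W`, then `lyapunovOp A X ≤ 0` implies `0 ≤ X`. -/
lemma posSemidef_of_neg_lyapunovOp {A W X : Matrix (Fin n) (Fin n) ℂ} (hW : W.PosDef)
    (hAW : (-lyapunovOp A W).PosDef) (hX : X.IsHermitian)
    (hAX : (-lyapunovOp A X).PosSemidef) : X.PosSemidef := by
  -- Continuity method along the ray `W + s X`: `S` is closed and contains 0. The strict inequality
  -- upgrades semidefinite to definite at each of its points `s ≥ 0`, so `S` extends to the right
  -- and contains every `s ≥ 0`.
  let S : Set ℝ := {s | (W + s • X).PosSemidef}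
  have hclosed : IsClosed S :=
    isClosed_posSemidef.preimage (by fun_prop : Continuous fun s : ℝ => W + s • X)
  have hstep : ∀ s, 0 ≤ s → s ∈ S → ∃ δ > 0, ∀ t, 0 ≤ t → t ≤ δ → s + t ∈ S := by
    intro s hs hsS
    have h1 : (W + s • X).PosDef := by
      refine Matrix.PosSemidef.posDef_of_lyapunovOp (A := A) hsS ?_
      rw [map_add, lyapunovOp_real_smul, neg_add, ← smul_neg]
      exact hAW.add_posSemidef (hAX.real_smul hs)
    obtain ⟨ε, hε, h2⟩ := h1.exists_sub_smul_one_posSemidef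
    refine ⟨ε / (‖X‖ + 1), by positivity, fun t ht htε => ?_⟩
    have h3 : (‖X‖ • 1 + X).PosSemidef := by
      simpa using hX.neg.norm_smul_one_sub_posSemidef
    have h4 : 0 ≤ ε - t * ‖X‖ := by
      rw [le_div_iff₀ (by positivity)] at htε
      nlinarith
    have h5 := (h2.add (h3.real_smul ht)).add
      ((PosSemidef.one (n := Fin n) (R := ℂ)).real_smul h4)
    have h6 : W + (s + t) • X =
        W + s • X - ε • 1 + t • (‖X‖ • 1 + X) + (ε - t * ‖X‖) • 1 := by module
    change (W + (s + t) • X).PosSemidef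
    rwa [h6]
  have hall : ∀ b : ℝ, 0 ≤ b → b ∈ S := by
    intro b hb
    have h := (hclosed.inter isClosed_Icc : IsClosed (S ∩ Set.Icc 0 b)).Icc_subset_of_forall_exists_gt
      (by simpa [S] using hW.posSemidef) (fun x hx y hy => ?_)
    · exact h ⟨hb, le_rfl⟩
    · obtain ⟨δ, hδ, h1⟩ := hstep x hx.2.1 hx.1
      have hxy : 0 < y - x := sub_pos.mpr hy
      refine ⟨x + min δ (y - x), h1 _ (by positivity) (min_le_left _ _), ?_, ?_⟩
      · exact lt_add_of_pos_right _ (lt_min hδ hxy)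
      · linarith [min_le_right δ (y - x)]
  refine hX.posSemidef_of_re fun v => ?_
  by_contra! hv
  set w := (trace (vᴴ * W * v)).re
  set x := (trace (vᴴ * X * v)).re
  have hw : 0 ≤ w := hW.posSemidef.re_quadratic_nonneg v
  -- If `x < 0`, this parameter makes the quadratic form of `W + s X` equal to `-1`.
  have h1 := (hall ((w + 1) / -x) (div_nonneg (by linarith) (by linarith))).re_quadratic_nonneg v
  rw [Matrix.mul_add, Matrix.add_mul, trace_add, Complex.add_re, Matrix.mul_smul, Matrix.smul_mul,
    re_trace_real_smul] at h1
  have h2 : (w + 1) / -x * x = -(w + 1) := by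
    field_simp [hv.ne]
  change 0 ≤ w + (w + 1) / -x * x at h1
  linarith

/-- A Lyapunov certificate bounds the inverse Lyapunov operator on Hermitian matrices. -/
lemma norm_le_of_lyapunov_certificate {A W X : Matrix (Fin n) (Fin n) ℂ} {ε : ℝ} (hε : 0 < ε)
    (hW : W.PosDef) (hAW : (-lyapunovOp A W - ε • 1).PosSemidef) (hX : X.IsHermitian) :
    ‖X‖ ≤ ‖lyapunovOp A X‖ / ε * (trace W).re := by
  -- Used for `Z = X` and `Z = -X`: it gives `-c W ≤ X ≤ c W` with `c = ‖lyapunovOp A X‖ / ε`.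
  have key : ∀ Z : Matrix (Fin n) (Fin n) ℂ, Z.IsHermitian → ‖lyapunovOp A Z‖ = ‖lyapunovOp A X‖ →
      ((‖lyapunovOp A X‖ / ε) • W + Z).PosSemidef := by
    intro Z hZ hZX
    have h0 : 0 ≤ ‖lyapunovOp A X‖ / ε := by positivity
    refine posSemidef_of_neg_lyapunovOp hW (hAW.posDef_of_sub_smul_one hε)
      ((hW.1.real_smul _).add hZ) ?_
    have h1 := (hAW.real_smul h0).add (lyapunovOp_isHermitian (A := A) hZ).norm_smul_one_sub_posSemidef
    have h2 : -lyapunovOp A ((‖lyapunovOp A X‖ / ε) • W + Z) =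
        (‖lyapunovOp A X‖ / ε) • (-lyapunovOp A W - ε • 1) + (‖lyapunovOp A Z‖ • 1 - lyapunovOp A Z) := by
      rw [map_add, lyapunovOp_real_smul, hZX, smul_sub, smul_smul, div_mul_cancel₀ _ hε.ne']
      module
    rwa [h2]
  have h1 := (key X hX rfl).norm_le_re_trace
  have h2 := (key (-X) hX.neg (by rw [map_neg, norm_neg])).norm_le_re_trace
  rw [trace_add, Complex.add_re, re_trace_real_smul] at h1 h2
  rw [trace_neg, Complex.neg_re] at h2
  set P := (‖lyapunovOp A X‖ / ε) • W
  have h3 : ‖(P + X) - (P + -X)‖ ≤ ‖P + X‖ + ‖P + -X‖ := norm_sub_le _ _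
  have h4 : (P + X) - (P + -X) = (2 : ℝ) • X := by module
  rw [h4, norm_smul, Real.norm_ofNat] at h3
  linarith

/-- The norm bound gives injectivity on Hermitian matrices; a general kernel element is handled
through `X + X*` and `i (X - X*)`, both Hermitian and in the kernel. -/
lemma isUnit_lyapunovOp_of_certificate {A W : Matrix (Fin n) (Fin n) ℂ} (hW : W.PosDef)
    (hAW : (-lyapunovOp A W).PosDef) : IsUnit (lyapunovOp A) := by
  obtain ⟨ε, hε, hεW⟩ := hAW.exists_sub_smul_one_posSemidef
  have key : ∀ X : Matrix (Fin n) (Fin n) ℂ, X.IsHermitian → lyapunovOp A X = 0 → X = 0 := by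
    intro X hX h
    have h1 := norm_le_of_lyapunov_certificate hε hW hεW hX
    rw [h, norm_zero, zero_div, zero_mul] at h1
    exact norm_le_zero_iff.mp h1
  rw [LinearMap.isUnit_iff_ker_eq_bot, LinearMap.ker_eq_bot']
  intro X hX
  have hX' : lyapunovOp A Xᴴ = 0 := by rw [lyapunovOp_conjTranspose, hX, conjTranspose_zero]
  have h1 : X + Xᴴ = 0 := key _ (by simp [IsHermitian, add_comm]) (by rw [map_add, hX, hX', add_zero])
  have h2 : Complex.I • (X - Xᴴ) = 0 := by
    refine key _ ?_ (by rw [map_smul, map_sub, hX, hX', sub_zero, smul_zero])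
    rw [IsHermitian, conjTranspose_smul, conjTranspose_sub, conjTranspose_conjTranspose,
      Complex.star_def, Complex.conj_I, neg_smul, ← smul_neg, neg_sub]
  have h3 : X - Xᴴ = 0 := (smul_eq_zero.mp h2).resolve_left Complex.I_ne_zero
  have h4 : (2 : ℝ) • X = (X + Xᴴ) + (X - Xᴴ) := by module
  rw [h1, h3, add_zero] at h4
  exact (smul_eq_zero.mp h4).resolve_left two_ne_zero

lemma isHermitian_of_lyapunovOp {A X : Matrix (Fin n) (Fin n) ℂ} (hA : IsUnit (lyapunovOp A))
    (h : (lyapunovOp A X).IsHermitian) : X.IsHermitian := by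
  refine ((Module.End.isUnit_iff _).mp hA).1 ?_
  rw [lyapunovOp_conjTranspose, h.eq]

/-- With a Lyapunov certificate, every Lyapunov equation with positive definite right-hand side has
a positive definite solution. -/
lemma exists_posDef_lyapunovOp_eq {A W V : Matrix (Fin n) (Fin n) ℂ} (hW : W.PosDef)
    (hAW : (-lyapunovOp A W).PosDef) (hV : V.PosDef) :
    ∃ X : Matrix (Fin n) (Fin n) ℂ, X.PosDef ∧ lyapunovOp A X = -V := by
  have hu := isUnit_lyapunovOp_of_certificate hW hAW
  obtain ⟨X, hX⟩ := ((Module.End.isUnit_iff _).mp hu).2 (-V)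
  have hXH : X.IsHermitian := isHermitian_of_lyapunovOp hu (by rw [hX]; exact hV.1.neg)
  have hneg : -lyapunovOp A X = V := by rw [hX, neg_neg]
  exact ⟨X, (posSemidef_of_neg_lyapunovOp hW hAW hXH (hneg ▸ hV.posSemidef)).posDef_of_lyapunovOp
    (hneg ▸ hV), hX⟩

lemma eq_zero_of_controllable {A : Matrix (Fin n) (Fin n) ℂ} {B : Matrix (Fin n) (Fin m) ℂ}
    (hAB : IsControllable A B) {v : Matrix (Fin n) (Fin 1) ℂ}
    (h : ∀ k : ℕ, Bᴴ * (Aᴴ) ^ k * v = 0) : v = 0 := by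
  have h1 : (controllabilityMatrix A B)ᴴ * v = 0 := by
    ext ⟨k, j⟩ i
    have h2 := congrFun (congrFun (h k) j) i
    rw [← conjTranspose_pow, ← conjTranspose_mul, Matrix.mul_apply] at h2
    rw [Matrix.mul_apply]
    exact h2
  have h3 : Function.Injective (controllabilityMatrix A B)ᴴ.mulVec := by
    rw [Matrix.mulVec_injective_iff, linearIndependent_iff_card_eq_finrank_span,
      Set.finrank, ← Matrix.rank_eq_finrank_span_cols, rank_conjTranspose, hAB, Fintype.card_fin]
  ext i j
  have h4 : (fun i => v i j) = 0 := by
    apply h3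
    ext q
    simpa [Matrix.mul_apply, mulVec, dotProduct] using congrFun (congrFun h1 q) j
  simpa using congrFun h4 i

/-- Bass' construction: a controllable pair has a positive definite solution `W` of
`A W + W A* - B B* = -2 β W` with `β > 0`. -/
lemma exists_posDef_lyapunovOp_sub {A : Matrix (Fin n) (Fin n) ℂ} {B : Matrix (Fin n) (Fin m) ℂ}
    (hAB : IsControllable A B) :
    ∃ W : Matrix (Fin n) (Fin n) ℂ, W.PosDef ∧ (-(lyapunovOp A W - B * Bᴴ)).PosDef := by
  -- This shift makes `A + A* + 2 β I` positive definite, so the identity is a certificate for `D =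
  -- -(A + β I)`.
  set β : ℝ := ‖A + Aᴴ‖ + 1
  set D : Matrix (Fin n) (Fin n) ℂ := -(A + β • 1)
  have hDapp : ∀ X, lyapunovOp D X = -(lyapunovOp A X + (2 * β) • X) := by
    intro X
    simp only [D, lyapunovOp_apply, conjTranspose_neg, conjTranspose_add, conjTranspose_real_smul,
      conjTranspose_one, Matrix.neg_mul, Matrix.mul_neg, Matrix.add_mul, Matrix.mul_add,
      Matrix.smul_mul, Matrix.mul_smul, Matrix.one_mul, Matrix.mul_one]
    module
  have hcert : (-lyapunovOp D 1).PosDef := by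
    have h1 : (A + Aᴴ).IsHermitian := by simp [IsHermitian, add_comm]
    have h2 : (‖A + Aᴴ‖ • 1 + (A + Aᴴ)).PosSemidef := by
      simpa only [norm_neg, sub_neg_eq_add] using h1.neg.norm_smul_one_sub_posSemidef
    have h3 := ((PosDef.one (n := Fin n) (R := ℂ)).real_smul
      (by positivity : 0 < ‖A + Aᴴ‖ + 2)).add_posSemidef h2
    have h4 : -lyapunovOp D 1 = (‖A + Aᴴ‖ + 2) • 1 + (‖A + Aᴴ‖ • 1 + (A + Aᴴ)) := by
      rw [hDapp, lyapunovOp_apply, Matrix.mul_one, Matrix.one_mul]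
      module
    rwa [h4]
  have hu := isUnit_lyapunovOp_of_certificate PosDef.one hcert
  obtain ⟨W, hW⟩ := ((Module.End.isUnit_iff _).mp hu).2 (-(B * Bᴴ))
  have hBB := posSemidef_self_mul_conjTranspose B
  have hneg : -lyapunovOp D W = B * Bᴴ := by rw [hW, neg_neg]
  have hWH : W.IsHermitian := isHermitian_of_lyapunovOp hu (by rw [hW]; exact hBB.1.neg)
  have hWS : W.PosSemidef := posSemidef_of_neg_lyapunovOp PosDef.one hcert hWH (hneg ▸ hBB)
  have hWeq : lyapunovOp A W + (2 * β) • W = B * Bᴴ := by rw [← hneg, hDapp, neg_neg]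
  -- The kernel of `W` is invariant under `A*` and lies in the kernel of `B*`, so controllability
  -- makes it trivial.
  have hker : ∀ v : Matrix (Fin n) (Fin 1) ℂ, W * v = 0 → Bᴴ * v = 0 ∧ W * (Aᴴ * v) = 0 := by
    intro v hv
    have h1 := quadratic_lyapunovOp_eq_zero (A := D) hWH hv
    rw [hW, Matrix.mul_neg, Matrix.neg_mul, neg_eq_zero] at h1
    have h2 : Bᴴ * v = 0 := by
      rw [← norm_eq_zero, ← sq_eq_zero_iff, frobenius_norm_sq, conjTranspose_mul,
        conjTranspose_conjTranspose, Matrix.mul_assoc, ← Matrix.mul_assoc B, ← Matrix.mul_assoc, h1]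
      simp
    refine ⟨h2, ?_⟩
    have h3 := congrArg (· * v) hWeq
    simpa [lyapunovOp_apply, Matrix.add_mul, Matrix.mul_assoc, hv, h2] using h3
  have hWP : W.PosDef := by
    refine hWS.posDef_of_mul_eq_zero fun v hv => eq_zero_of_controllable hAB fun k => ?_
    have h1 : ∀ k : ℕ, W * ((Aᴴ) ^ k * v) = 0 := by
      intro k
      induction k with
      | zero => simpa using hv
      | succ k ih => rw [pow_succ', Matrix.mul_assoc]; exact (hker _ ih).2
    rw [Matrix.mul_assoc]
    exact (hker _ (h1 k)).1
  refine ⟨W, hWP, ?_⟩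
  have h1 : -(lyapunovOp A W - B * Bᴴ) = (2 * β) • W := by rw [← hWeq]; abel
  rw [h1]
  exact hWP.real_smul (by positivity)

/-- A controllable pair is stabilizable, with a certificate for a prescribed right-hand side. -/
lemma exists_posDef_lyapunovOp_sub_inputOp {A V : Matrix (Fin n) (Fin n) ℂ}
    {B : Matrix (Fin n) (Fin m) ℂ} (hAB : IsControllable A B) (hV : V.PosDef) :
    ∃ (X : Matrix (Fin n) (Fin n) ℂ) (Y : Matrix (Fin m) (Fin n) ℂ),
      X.PosDef ∧ lyapunovOp A X - inputOp B Y = -V := by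
  obtain ⟨W, hW, hAW⟩ := exists_posDef_lyapunovOp_sub hAB
  have hWu := (Matrix.isUnit_iff_isUnit_det W).mp hW.isUnit
  -- The factor `1/2` gives `B K W + (B K W)* = B B*`, so `W` certifies `A - B K`.
  set K : Matrix (Fin m) (Fin n) ℂ := (1 / 2 : ℝ) • (Bᴴ * W⁻¹)
  have hK : ∀ X : Matrix (Fin n) (Fin n) ℂ, X.IsHermitian →
      lyapunovOp (A - B * K) X = lyapunovOp A X - inputOp B (K * X) := by
    intro X hX
    simp only [lyapunovOp_apply, inputOp, conjTranspose_sub, conjTranspose_mul, hX.eq,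
      Matrix.sub_mul, Matrix.mul_sub, Matrix.mul_assoc]
    abel
  have hKW : inputOp B (K * W) = B * Bᴴ := by
    have h1 : K * W = (1 / 2 : ℝ) • Bᴴ := by
      rw [Matrix.smul_mul, Matrix.nonsing_inv_mul_cancel_right _ _ hWu]
    rw [inputOp, h1, conjTranspose_real_smul, conjTranspose_conjTranspose, Matrix.mul_smul,
      Matrix.smul_mul]
    module
  obtain ⟨X, hX, hXV⟩ := exists_posDef_lyapunovOp_eq hW (A := A - B * K)
    (by rwa [hK W hW.1, hKW]) hV
  exact ⟨X, K * X, hX, by rw [← hK X hX.1, hXV]⟩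

end Lyapunov

/-! ### The affine map `Y ↦ X(Y)` and its domain -/

section Covariance

variable {n m : ℕ} {A V Q : Matrix (Fin n) (Fin n) ℂ} {B : Matrix (Fin n) (Fin m) ℂ}
  {R : Matrix (Fin m) (Fin m) ℂ}

lemma inputOp_isHermitian (B : Matrix (Fin n) (Fin m) ℂ) (Y : Matrix (Fin m) (Fin n) ℂ) :
    (inputOp B Y).IsHermitian := by
  simp [IsHermitian, inputOp, add_comm]

/-- `inputOp` as a real-linear map. -/
noncomputable def inputLinearMap (B : Matrix (Fin n) (Fin m) ℂ) :
    Matrix (Fin m) (Fin n) ℂ →ₗ[ℝ] Matrix (Fin n) (Fin n) ℂ where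
  toFun := inputOp B
  map_add' Y Z := by
    simp only [inputOp, Matrix.mul_add, conjTranspose_add, Matrix.add_mul]
    abel
  map_smul' c Y := by
    simp [inputOp]

/-- The linear part of `covarianceOf`. -/
noncomputable def covarianceLinearMap (A : Matrix (Fin n) (Fin n) ℂ)
    (B : Matrix (Fin n) (Fin m) ℂ) : Matrix (Fin m) (Fin n) ℂ →ₗ[ℝ] Matrix (Fin n) (Fin n) ℂ :=
  (Ring.inverse (lyapunovOp A)).restrictScalars ℝ ∘ₗ inputLinearMap B

lemma covarianceOf_eq (A : Matrix (Fin n) (Fin n) ℂ) (B : Matrix (Fin n) (Fin m) ℂ)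
    (V : Matrix (Fin n) (Fin n) ℂ) (Y : Matrix (Fin m) (Fin n) ℂ) :
    covarianceOf A B V Y = covarianceLinearMap A B Y - Ring.inverse (lyapunovOp A) V :=
  map_sub _ _ _

lemma contDiff_covarianceOf {k : WithTop ℕ∞} : ContDiff ℝ k (covarianceOf A B V) := by
  rw [funext (covarianceOf_eq A B V)]
  exact (LinearMap.toContinuousLinearMap (covarianceLinearMap A B)).contDiff.sub contDiff_const

lemma continuous_covarianceOf : Continuous (covarianceOf A B V) :=
  (contDiff_covarianceOf (k := 0)).continuous

lemma covarianceOf_convex_comb {s t : ℝ} (hst : s + t = 1) (Y Z : Matrix (Fin m) (Fin n) ℂ) :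
    covarianceOf A B V (s • Y + t • Z) = s • covarianceOf A B V Y + t • covarianceOf A B V Z := by
  simp only [covarianceOf_eq, map_add, map_smul]
  obtain rfl : s = 1 - t := by linarith
  module

lemma lyapunovOp_covarianceOf (hA : IsUnit (lyapunovOp A)) (Y : Matrix (Fin m) (Fin n) ℂ) :
    lyapunovOp A (covarianceOf A B V Y) = inputOp B Y - V := by
  rw [covarianceOf, ← Module.End.mul_apply, Ring.mul_inverse_cancel _ hA, Module.End.one_apply]

lemma covarianceOf_isHermitian (hA : IsUnit (lyapunovOp A)) (hV : V.IsHermitian)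
    (Y : Matrix (Fin m) (Fin n) ℂ) : (covarianceOf A B V Y).IsHermitian :=
  isHermitian_of_lyapunovOp hA (by
    rw [lyapunovOp_covarianceOf hA]; exact (inputOp_isHermitian B Y).sub hV)

lemma mem_stabilizingSet_iff (hA : IsUnit (lyapunovOp A)) {Y : Matrix (Fin m) (Fin n) ℂ} :
    Y ∈ stabilizingSet A B V ↔ (covarianceOf A B V Y).PosDef := by
  refine ⟨fun h => h.2, fun h => ⟨?_, h⟩⟩
  rw [lyapunovOp_covarianceOf hA]
  abel

lemma stabilizingSet_nonempty (hAB : IsControllable A B) (hV : V.PosDef)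
    (hA : IsUnit (lyapunovOp A)) : (stabilizingSet A B V).Nonempty := by
  obtain ⟨X, Y, hX, hXY⟩ := exists_posDef_lyapunovOp_sub_inputOp hAB hV
  refine ⟨Y, (mem_stabilizingSet_iff hA).mpr ?_⟩
  have h : covarianceOf A B V Y = X := by
    apply ((Module.End.isUnit_iff _).mp hA).1
    rw [lyapunovOp_covarianceOf hA, sub_eq_iff_eq_add.mp hXY]
    abel
  rwa [h]

lemma convex_stabilizingSet (hA : IsUnit (lyapunovOp A)) : Convex ℝ (stabilizingSet A B V) := by
  rw [convex_iff_forall_pos]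
  intro Y hY Z hZ s t hs ht hst
  rw [mem_stabilizingSet_iff hA] at hY hZ ⊢
  rw [covarianceOf_convex_comb hst]
  exact (hY.real_smul hs).add (hZ.real_smul ht)

lemma isOpen_stabilizingSet (hA : IsUnit (lyapunovOp A)) (hV : V.IsHermitian) :
    IsOpen (stabilizingSet A B V) := by
  rw [isOpen_iff_mem_nhds]
  intro Y hY
  obtain ⟨ε, hε, h⟩ := ((mem_stabilizingSet_iff hA).mp hY).exists_sub_smul_one_posSemidef
  have h1 : Metric.ball (covarianceOf A B V Y) ε ∈ nhds (covarianceOf A B V Y) :=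
    Metric.ball_mem_nhds _ hε
  filter_upwards [(continuous_covarianceOf (A := A) (B := B) (V := V)).continuousAt h1] with Z hZ
  rw [Set.mem_preimage, mem_ball_iff_norm'] at hZ
  rw [mem_stabilizingSet_iff hA]
  have h2 := ((covarianceOf_isHermitian (B := B) hA hV Y).sub
    (covarianceOf_isHermitian (B := B) hA hV Z)).norm_smul_one_sub_posSemidef
  -- A perturbation smaller than the margin `ε` leaves the margin `ε - ‖X(Y) - X(Z)‖`.
  refine Matrix.PosSemidef.posDef_of_sub_smul_one (sub_pos.mpr hZ) ?_
  have h3 := h.add h2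
  convert h3 using 1
  module

end Covariance

/-! ### Reality and smoothness of the cost -/

section Cost

variable {n m : ℕ} {A V Q : Matrix (Fin n) (Fin n) ℂ} {B : Matrix (Fin n) (Fin m) ℂ}
  {R : Matrix (Fin m) (Fin m) ℂ}

lemma lqrTrace_eq (A V Q : Matrix (Fin n) (Fin n) ℂ) (B : Matrix (Fin n) (Fin m) ℂ)
    (R : Matrix (Fin m) (Fin m) ℂ) (Y : Matrix (Fin m) (Fin n) ℂ) :
    lqrTrace A B V Q R Y = trace (Q * covarianceOf A B V Y) +
      trace (R * (Y * (covarianceOf A B V Y)⁻¹ * Yᴴ)) := by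
  rw [lqrTrace, trace_add, Matrix.mul_assoc, Matrix.mul_assoc, trace_mul_comm Yᴴ]
  simp only [Matrix.mul_assoc]

lemma lqrCost_eq (A V Q : Matrix (Fin n) (Fin n) ℂ) (B : Matrix (Fin n) (Fin m) ℂ)
    (R : Matrix (Fin m) (Fin m) ℂ) (Y : Matrix (Fin m) (Fin n) ℂ) :
    lqrCost A B V Q R Y = (trace (Q * covarianceOf A B V Y)).re +
      (trace (R * (Y * (covarianceOf A B V Y)⁻¹ * Yᴴ))).re := by
  rw [lqrCost, lqrTrace_eq, Complex.add_re]

lemma Matrix.IsHermitian.im_trace_mul {M N : Matrix (Fin n) (Fin n) ℂ} (hM : M.IsHermitian)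
    (hN : N.IsHermitian) : (trace (M * N)).im = 0 := by
  refine Complex.conj_eq_iff_im.mp ?_
  change star (trace (M * N)) = _
  rw [← trace_conjTranspose, conjTranspose_mul, hM.eq, hN.eq, trace_mul_comm]

lemma lqrTrace_im (hQ : Q.IsHermitian) (hR : R.IsHermitian) {Y : Matrix (Fin m) (Fin n) ℂ}
    (hX : (covarianceOf A B V Y).PosDef) : (lqrTrace A B V Q R Y).im = 0 := by
  rw [lqrTrace_eq, Complex.add_im, hQ.im_trace_mul hX.1,
    hR.im_trace_mul (hX.posSemidef.inv.mul_mul_conjTranspose_same Y).1, add_zero]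

lemma contDiffAt_nonsing_inv {M : Matrix (Fin n) (Fin n) ℂ} (hM : IsUnit M)
    {k : WithTop ℕ∞} : ContDiffAt ℝ k (fun N : Matrix (Fin n) (Fin n) ℂ => N⁻¹) M := by
  let _ : NormedRing (Matrix (Fin n) (Fin n) ℂ) := Matrix.frobeniusNormedRing
  let _ : NormedAlgebra ℝ (Matrix (Fin n) (Fin n) ℂ) := Matrix.frobeniusNormedAlgebra
  obtain ⟨u, rfl⟩ := hM
  have h := contDiffAt_ringInverse ℝ (n := k) u
  have h1 : (fun N : Matrix (Fin n) (Fin n) ℂ => N⁻¹) = Ring.inverse :=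
    funext Matrix.nonsing_inv_eq_ringInverse
  rw [h1]
  exact h

lemma ContDiffAt.matrix_mul {E : Type*} [NormedAddCommGroup E] [NormedSpace ℝ E] {a b c : ℕ}
    {k : WithTop ℕ∞} {x : E} {f : E → Matrix (Fin a) (Fin b) ℂ} {g : E → Matrix (Fin b) (Fin c) ℂ}
    (hf : ContDiffAt ℝ k f x) (hg : ContDiffAt ℝ k g x) :
    ContDiffAt ℝ k (fun y => f y * g y) x := by
  have h : IsBoundedBilinearMap ℝ
      (fun p : Matrix (Fin a) (Fin b) ℂ × Matrix (Fin b) (Fin c) ℂ => p.1 * p.2) :=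
    { add_left := fun _ _ _ => Matrix.add_mul _ _ _
      smul_left := fun _ _ _ => Matrix.smul_mul _ _ _
      add_right := fun _ _ _ => Matrix.mul_add _ _ _
      smul_right := fun _ _ _ => Matrix.mul_smul _ _ _
      bound := ⟨1, one_pos, fun p q => by
        simpa using frobenius_norm_mul p q⟩ }
  exact h.contDiff.contDiffAt.comp x (hf.prodMk hg)

lemma contDiff_re_trace {k : WithTop ℕ∞} :
    ContDiff ℝ k (fun M : Matrix (Fin n) (Fin n) ℂ => (trace M).re) :=
  (LinearMap.toContinuousLinearMap
    (Complex.reLm ∘ₗ (traceLinearMap (Fin n) ℝ ℂ))).contDiff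

lemma contDiff_conjTranspose {k : WithTop ℕ∞} :
    ContDiff ℝ k (fun M : Matrix (Fin m) (Fin n) ℂ => Mᴴ) :=
  (LinearMap.toContinuousLinearMap
    ({ toFun := conjTranspose, map_add' := conjTranspose_add, map_smul' := conjTranspose_real_smul } :
      Matrix (Fin m) (Fin n) ℂ →ₗ[ℝ] Matrix (Fin n) (Fin m) ℂ)).contDiff

lemma contDiffAt_lqrCost {Y : Matrix (Fin m) (Fin n) ℂ} (hX : (covarianceOf A B V Y).PosDef)
    {k : WithTop ℕ∞} : ContDiffAt ℝ k (lqrCost A B V Q R) Y := by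
  rw [funext (lqrCost_eq A V Q B R)]
  have h1 : ContDiffAt ℝ k (covarianceOf A B V) Y := contDiff_covarianceOf.contDiffAt
  have h2 : ContDiffAt ℝ k (fun Z => (covarianceOf A B V Z)⁻¹) Y :=
    (contDiffAt_nonsing_inv hX.isUnit).comp Y h1
  exact (contDiff_re_trace.contDiffAt.comp Y (contDiffAt_const.matrix_mul h1)).add
    (contDiff_re_trace.contDiffAt.comp Y (contDiffAt_const.matrix_mul
      ((contDiffAt_id.matrix_mul h2).matrix_mul contDiff_conjTranspose.contDiffAt)))

end Cost

/-! ### Lipschitz gradients on compact convex sets -/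

section LipschitzGradient

/-- A function that is `C²` near a compact convex set has a Lipschitz gradient on it. -/
lemma exists_lipschitzOnWith_gradient {E : Type*} [NormedAddCommGroup E] [InnerProductSpace ℝ E]
    [CompleteSpace E] {f : E → ℝ} {s : Set E} (hs : IsCompact s) (hc : Convex ℝ s)
    (hf : ∀ x ∈ s, ContDiffAt ℝ 2 f x) :
    ∃ L : NNReal, 0 < L ∧ LipschitzOnWith L (∇ f) s := by
  have h1 : ∀ x ∈ s, ContDiffAt ℝ 1 (fderiv ℝ f) x := fun x hx =>
    (hf x hx).fderiv_right (by norm_num)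
  have h2 : ContinuousOn (fderiv ℝ (fderiv ℝ f)) s := fun x hx =>
    ((h1 x hx).fderiv_right (m := 0) (by norm_num)).continuousAt.continuousWithinAt
  obtain ⟨C, hC⟩ := hs.exists_bound_of_continuousOn (f := fderiv ℝ (fderiv ℝ f)) h2
  have h3 : LipschitzOnWith (C.toNNReal + 1) (fderiv ℝ f) s := by
    refine hc.lipschitzOnWith_of_nnnorm_fderiv_le
      (fun x hx => (h1 x hx).differentiableAt (by norm_num)) fun x hx => ?_
    exact (NNReal.le_toNNReal_of_coe_le (hC x hx)).trans le_self_add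
  refine ⟨C.toNNReal + 1, by positivity, fun x hx y hy => ?_⟩
  -- The gradient is the derivative followed by the Riesz isometry, so Lipschitz constants carry
  -- over.
  simp only [gradient, LinearIsometryEquiv.edist_map]
  exact h3 hx hy

end LipschitzGradient

/-! ### Uniform bounds, compactness and closedness -/

section SublevelBounds

variable {n m : ℕ} {A V Q : Matrix (Fin n) (Fin n) ℂ} {B : Matrix (Fin n) (Fin m) ℂ}
  {R : Matrix (Fin m) (Fin m) ℂ}

/-- Write `X = C* C`. Both `‖Y v‖` and `‖X v‖` are at most a constant times `‖C v‖`, so `v* V v = 2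
Re v* B Y v - 2 Re v* A X v` yields `ε ‖v‖² ≤ c ‖v‖ ‖C v‖`, while `‖C v‖² = v* X v`. -/
lemma covarianceOf_sub_smul_one_posSemidef (hA : IsUnit (lyapunovOp A))
    {Y : Matrix (Fin m) (Fin n) ℂ}
    (hX : (covarianceOf A B V Y).PosDef) {ε α τ : ℝ} (hε : 0 < ε) (hεV : (V - ε • 1).PosSemidef)
    (hτ : (trace (covarianceOf A B V Y)).re ≤ τ)
    (hα : (trace (Y * (covarianceOf A B V Y)⁻¹ * Yᴴ)).re ≤ α) :
    (covarianceOf A B V Y - (ε / (2 * (‖B‖ * √α + ‖A‖ * √τ) + 1)) ^ 2 • 1).PosSemidef := by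
  set X := covarianceOf A B V Y
  obtain ⟨C, hC⟩ := hX.posSemidef.exists_conjTranspose_mul_self
  have hCu : IsUnit C.det := by
    have h := (Matrix.isUnit_iff_isUnit_det X).mp hX.isUnit
    rw [hC, det_mul] at h
    exact isUnit_of_mul_isUnit_right h
  have hH : ‖Y * C⁻¹‖ ≤ √α := by
    refine Real.le_sqrt_of_sq_le (le_trans (le_of_eq ?_) hα)
    rw [← frobenius_norm_conjTranspose, frobenius_norm_sq, conjTranspose_conjTranspose,
      conjTranspose_mul, hC, Matrix.mul_inv_rev, conjTranspose_nonsing_inv]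
    simp only [Matrix.mul_assoc]
  have hCn : ‖C‖ ≤ √τ := by
    refine Real.le_sqrt_of_sq_le ?_
    rwa [frobenius_norm_sq, ← hC]
  set c := 2 * (‖B‖ * √α + ‖A‖ * √τ) + 1
  have hc : 0 < c := by positivity
  refine (hX.1.sub (isHermitian_one.real_smul _)).posSemidef_of_re fun v => ?_
  rw [re_quadratic_sub_smul_one, sub_nonneg]
  have hCv : (trace (vᴴ * X * v)).re = ‖C * v‖ ^ 2 := by
    rw [frobenius_norm_sq, conjTranspose_mul, hC]
    simp only [Matrix.mul_assoc]
  rw [hCv]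
  have hYv : ‖Y * v‖ ≤ √α * ‖C * v‖ := by
    have h : Y * v = Y * C⁻¹ * (C * v) := by
      rw [Matrix.mul_assoc, Matrix.nonsing_inv_mul_cancel_left C v hCu]
    rw [h]
    exact (frobenius_norm_mul _ _).trans (by gcongr)
  have hXv : ‖X * v‖ ≤ √τ * ‖C * v‖ := by
    rw [hC, Matrix.mul_assoc]
    refine (frobenius_norm_mul _ _).trans ?_
    rw [frobenius_norm_conjTranspose]
    gcongr
  have hVv : (trace (vᴴ * V * v)).re =
      2 * (trace (vᴴ * (B * (Y * v)))).re + 2 * (trace ((-v)ᴴ * (A * (X * v)))).re := by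
    have h1 : V = inputOp B Y - lyapunovOp A X := by
      rw [lyapunovOp_covarianceOf hA]; abel
    have h2 : ∀ M : Matrix (Fin n) (Fin n) ℂ,
        (trace (vᴴ * Mᴴ * v)).re = (trace (vᴴ * M * v)).re := by
      intro M
      have h3 : vᴴ * Mᴴ * v = (vᴴ * M * v)ᴴ := by simp [Matrix.mul_assoc]
      rw [h3, trace_conjTranspose, Complex.star_def, Complex.conj_re]
    have h4 : Yᴴ * Bᴴ = (B * Y)ᴴ := by rw [conjTranspose_mul]
    have h5 : X * Aᴴ = (A * X)ᴴ := by rw [conjTranspose_mul, hX.1.eq]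
    rw [h1, inputOp, lyapunovOp_apply, h4, h5, Matrix.mul_sub, Matrix.sub_mul, Matrix.mul_add,
      Matrix.add_mul, Matrix.mul_add, Matrix.add_mul, trace_sub, trace_add, trace_add,
      Complex.sub_re, Complex.add_re, Complex.add_re, h2, h2, conjTranspose_neg, Matrix.neg_mul,
      trace_neg, Complex.neg_re]
    simp only [Matrix.mul_assoc]
    ring
  have h1 := hεV.re_quadratic_nonneg v
  rw [re_quadratic_sub_smul_one, hVv] at h1
  have h2 : (trace (vᴴ * (B * (Y * v)))).re ≤ ‖v‖ * (‖B‖ * (√α * ‖C * v‖)) :=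
    (re_trace_conjTranspose_mul_le _ _).trans (by
      gcongr; exact (frobenius_norm_mul _ _).trans (by gcongr))
  have h3 : (trace ((-v)ᴴ * (A * (X * v)))).re ≤ ‖v‖ * (‖A‖ * (√τ * ‖C * v‖)) :=
    (re_trace_conjTranspose_mul_le _ _).trans (by
      rw [norm_neg]; gcongr; exact (frobenius_norm_mul _ _).trans (by gcongr))
  have h4 : ‖v‖ * (ε * ‖v‖) ≤ ‖v‖ * (c * ‖C * v‖) := by
    have : 0 ≤ ‖v‖ * ‖C * v‖ := by positivity
    simp only [c]
    nlinarith
  have h5 : ε * ‖v‖ ≤ c * ‖C * v‖ := by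
    rcases (norm_nonneg v).eq_or_lt with h0 | h0
    · rw [← h0, mul_zero]; positivity
    · exact le_of_mul_le_mul_left h4 h0
  rw [← mul_pow]
  have h6 : ε / c * ‖v‖ ≤ ‖C * v‖ := by
    rw [div_mul_eq_mul_div, div_le_iff₀ hc]
    linarith
  gcongr

/-- Uniform bounds on a sublevel set of the cost: the covariance is bounded and bounded away from
singularity, and the feedback energy is bounded. -/
lemma exists_sublevel_bounds (hA : IsUnit (lyapunovOp A)) (hV : V.PosDef) (hQ : Q.PosDef)
    (hR : R.PosDef) (a : ℝ) :
    ∃ δ τ α : ℝ, 0 < δ ∧ 0 ≤ τ ∧ 0 ≤ α ∧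
      ∀ Y ∈ sublevelSet (stabilizingSet A B V) (lqrCost A B V Q R) a,
        (covarianceOf A B V Y - δ • 1).PosSemidef ∧ (trace (covarianceOf A B V Y)).re ≤ τ ∧
          (trace (Y * (covarianceOf A B V Y)⁻¹ * Yᴴ)).re ≤ α := by
  obtain ⟨ε, hε, hεV⟩ := hV.exists_sub_smul_one_posSemidef
  obtain ⟨q, hq, hqQ⟩ := hQ.exists_sub_smul_one_posSemidef
  obtain ⟨r, hr, hrR⟩ := hR.exists_sub_smul_one_posSemidef
  refine ⟨(ε / (2 * (‖B‖ * √(|a| / r) + ‖A‖ * √(|a| / q)) + 1)) ^ 2, |a| / q, |a| / r,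
    by positivity, by positivity, by positivity, fun Y hY => ?_⟩
  have hX : (covarianceOf A B V Y).PosDef := hY.1.2
  have hP := hX.posSemidef.inv.mul_mul_conjTranspose_same Y
  have h1 := mul_re_trace_le_re_trace_mul hqQ hX.posSemidef
  have h2 := mul_re_trace_le_re_trace_mul hrR hP
  have h3 := mul_nonneg hq.le hX.posSemidef.re_trace_nonneg
  have h4 := mul_nonneg hr.le hP.re_trace_nonneg
  have h5 := hY.2
  rw [lqrCost_eq] at h5
  have h6 := le_abs_self a
  have hτ : (trace (covarianceOf A B V Y)).re ≤ |a| / q := by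
    rw [le_div_iff₀ hq]; linarith
  have hα : (trace (Y * (covarianceOf A B V Y)⁻¹ * Yᴴ)).re ≤ |a| / r := by
    rw [le_div_iff₀ hr]; linarith
  exact ⟨covarianceOf_sub_smul_one_posSemidef hA hX hε hεV hτ hα, hτ, hα⟩

/-- With `K = Y X⁻¹` one has `Y X⁻¹ Y* = K X K*`, and `X ≥ δ I`. This bounds the gain by the
feedback energy. -/
lemma sq_norm_mul_inv_le {X : Matrix (Fin n) (Fin n) ℂ} {δ : ℝ} (hX : X.PosDef)
    (hδ : (X - δ • 1).PosSemidef) (Y : Matrix (Fin m) (Fin n) ℂ) :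
    δ * ‖Y * X⁻¹‖ ^ 2 ≤ (trace (Y * X⁻¹ * Yᴴ)).re := by
  have h := hδ.re_quadratic_nonneg (Y * X⁻¹)ᴴ
  have hu := (Matrix.isUnit_iff_isUnit_det X).mp hX.isUnit
  rw [re_quadratic_sub_smul_one, frobenius_norm_conjTranspose, conjTranspose_conjTranspose,
    Matrix.mul_assoc Y, Matrix.nonsing_inv_mul X hu, Matrix.mul_one, conjTranspose_mul,
    conjTranspose_nonsing_inv, hX.1.eq, ← Matrix.mul_assoc] at h
  linarith

lemma isCompact_sublevelSet (hA : IsUnit (lyapunovOp A)) (hV : V.PosDef) (hQ : Q.PosDef)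
    (hR : R.PosDef) (a : ℝ) :
    IsCompact (sublevelSet (stabilizingSet A B V) (lqrCost A B V Q R) a) := by
  obtain ⟨δ, τ, α, hδ, hτ, hα, h⟩ := exists_sublevel_bounds (B := B) hA hV hQ hR a
  set S := sublevelSet (stabilizingSet A B V) (lqrCost A B V Q R) a
  have hbdd : Bornology.IsBounded S := by
    refine isBounded_iff_forall_norm_le.mpr ⟨√(α / δ) * τ, fun Y hY => ?_⟩
    obtain ⟨h1, h2, h3⟩ := h Y hY
    have hX : (covarianceOf A B V Y).PosDef := hY.1.2
    have hu := (Matrix.isUnit_iff_isUnit_det _).mp hX.isUnit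
    rw [← Matrix.nonsing_inv_mul_cancel_right (covarianceOf A B V Y) Y hu]
    refine (frobenius_norm_mul _ _).trans ?_
    gcongr
    · refine Real.le_sqrt_of_sq_le ?_
      rw [le_div_iff₀ hδ, mul_comm]
      exact (sq_norm_mul_inv_le hX h1 Y).trans h3
    · exact hX.posSemidef.norm_le_re_trace.trans h2
  refine Metric.isCompact_of_isClosed_isBounded ?_ hbdd
  have hT : IsClosed {Y : Matrix (Fin m) (Fin n) ℂ | (covarianceOf A B V Y - δ • 1).PosSemidef} :=
    isClosed_posSemidef.preimage (continuous_covarianceOf.sub continuous_const)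
  have hcont : ContinuousOn (lqrCost A B V Q R)
      {Y : Matrix (Fin m) (Fin n) ℂ | (covarianceOf A B V Y - δ • 1).PosSemidef} := fun Y hY =>
    (contDiffAt_lqrCost (hY.posDef_of_sub_smul_one hδ) (k := 0)).continuousAt.continuousWithinAt
  -- The uniform bound replaces the open condition `X ≻ 0` by the closed one `X ≥ δ I`, on which the
  -- cost is continuous.
  have hS : S = {Y : Matrix (Fin m) (Fin n) ℂ | (covarianceOf A B V Y - δ • 1).PosSemidef} ∩
      lqrCost A B V Q R ⁻¹' Set.Iic a :=
    Set.ext fun Y => ⟨fun hY => ⟨(h Y hY).1, hY.2⟩, fun hY =>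
      ⟨(mem_stabilizingSet_iff hA).mpr (PosSemidef.posDef_of_sub_smul_one hδ hY.1), hY.2⟩⟩
  rw [hS]
  exact hcont.preimage_isClosed_of_isClosed hT isClosed_Iic

lemma isClosed_epigraph_lqrCost (hA : IsUnit (lyapunovOp A)) (hV : V.PosDef) (hQ : Q.PosDef)
    (hR : R.PosDef) :
    IsClosed {p : Matrix (Fin m) (Fin n) ℂ × ℝ |
      p.1 ∈ stabilizingSet A B V ∧ lqrCost A B V Q R p.1 ≤ p.2} := by
  set E := {p : Matrix (Fin m) (Fin n) ℂ × ℝ |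
      p.1 ∈ stabilizingSet A B V ∧ lqrCost A B V Q R p.1 ≤ p.2}
  refine isClosed_of_closure_subset fun p hp => ?_
  -- Near `p` only heights below `p.2 + 1` matter, so the limit is taken inside one compact sublevel
  -- set.
  have hU : {q : Matrix (Fin m) (Fin n) ℂ × ℝ | q.2 < p.2 + 1} ∈ nhds p :=
    (isOpen_lt continuous_snd continuous_const).mem_nhds (lt_add_one p.2)
  set S := sublevelSet (stabilizingSet A B V) (lqrCost A B V Q R) (p.2 + 1)
  have hS : IsClosed S := (isCompact_sublevelSet hA hV hQ hR _).isClosed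
  have hcont : ContinuousOn (fun q : Matrix (Fin m) (Fin n) ℂ × ℝ => lqrCost A B V Q R q.1 - q.2)
      (Prod.fst ⁻¹' S) := fun q hq =>
    (((contDiffAt_lqrCost hq.1.2 (k := 0)).continuousAt.comp continuousAt_fst).sub
      continuousAt_snd).continuousWithinAt
  have hF := hcont.preimage_isClosed_of_isClosed (hS.preimage continuous_fst)
    (isClosed_Iic (a := 0))
  have hsub : E ∩ {q | q.2 < p.2 + 1} ⊆ Prod.fst ⁻¹' S ∩
      (fun q : Matrix (Fin m) (Fin n) ℂ × ℝ => lqrCost A B V Q R q.1 - q.2) ⁻¹' Set.Iic 0 :=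
    fun q hq => ⟨⟨hq.1.1, hq.1.2.trans (le_of_lt hq.2)⟩, sub_nonpos.mpr hq.1.2⟩
  have hmem := closure_minimal hsub hF (mem_closure_iff_nhds.mpr fun t ht => by
    obtain ⟨q, hq⟩ := mem_closure_iff_nhds.mp hp _ (Filter.inter_mem ht hU)
    exact ⟨q, hq.1.1, hq.2, hq.1.2⟩)
  exact ⟨hmem.1.1, sub_nonpos.mp hmem.2⟩

end SublevelBounds

/-! ### Convexity and strong convexity -/

section Convexity

variable {n m : ℕ} {A V Q : Matrix (Fin n) (Fin n) ℂ} {B : Matrix (Fin n) (Fin m) ℂ}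
  {R : Matrix (Fin m) (Fin m) ℂ}

/-- The convexity defect of the matrix fractional function `(Y, X) ↦ Y X⁻¹ Y*`. -/
lemma matrix_fractional_defect {X Z : Matrix (Fin n) (Fin n) ℂ} (hX : X.PosDef) (hZ : Z.PosDef)
    (Y W : Matrix (Fin m) (Fin n) ℂ) {s t : ℝ} (hP : (s • X + t • Z).PosDef)
    {K : Matrix (Fin m) (Fin n) ℂ}
    (hK : K = (s • Y + t • W) * (s • X + t • Z)⁻¹) :
    s • (Y * X⁻¹ * Yᴴ) + t • (W * Z⁻¹ * Wᴴ) -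
        (s • Y + t • W) * (s • X + t • Z)⁻¹ * (s • Y + t • W)ᴴ =
      s • ((Y * X⁻¹ - K) * X * (Y * X⁻¹ - K)ᴴ) + t • ((W * Z⁻¹ - K) * Z * (W * Z⁻¹ - K)ᴴ) := by
  have huX := (Matrix.isUnit_iff_isUnit_det X).mp hX.isUnit
  have huZ := (Matrix.isUnit_iff_isUnit_det Z).mp hZ.isUnit
  have huP := (Matrix.isUnit_iff_isUnit_det _).mp hP.isUnit
  have h1 : K * (s • X + t • Z) = s • Y + t • W := by
    rw [hK, Matrix.nonsing_inv_mul_cancel_right _ _ huP]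
  have expand : ∀ (M : Matrix (Fin n) (Fin n) ℂ) (N : Matrix (Fin m) (Fin n) ℂ), M.PosDef →
      (N * M⁻¹ - K) * M * (N * M⁻¹ - K)ᴴ =
        N * M⁻¹ * Nᴴ - N * Kᴴ - K * Nᴴ + K * M * Kᴴ := by
    intro M N hM
    have hu := (Matrix.isUnit_iff_isUnit_det M).mp hM.isUnit
    rw [Matrix.sub_mul, Matrix.nonsing_inv_mul_cancel_right _ _ hu, conjTranspose_sub,
      conjTranspose_mul, conjTranspose_nonsing_inv, hM.1.eq, Matrix.mul_sub, Matrix.sub_mul,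
      Matrix.sub_mul, Matrix.mul_assoc K M (M⁻¹ * Nᴴ), Matrix.mul_nonsing_inv_cancel_left _ _ hu,
      ← Matrix.mul_assoc N]
    abel
  rw [expand X Y hX, expand Z W hZ, ← hK]
  -- The definition of `K` makes the cross terms of the completed squares cancel.
  have h2 : s • (K * X * Kᴴ) + t • (K * Z * Kᴴ) = s • (Y * Kᴴ) + t • (W * Kᴴ) := by
    have h3 := congrArg (· * Kᴴ) h1
    simpa only [Matrix.mul_add, Matrix.add_mul, Matrix.mul_smul, Matrix.smul_mul] using h3
  have h4 : K * (s • Y + t • W)ᴴ = s • (K * Yᴴ) + t • (K * Wᴴ) := by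
    simp only [conjTranspose_add, conjTranspose_real_smul, Matrix.mul_add, Matrix.mul_smul]
  rw [h4, smul_add, smul_add, smul_sub, smul_sub, smul_sub, smul_sub]
  have h5 : s • (Y * Kᴴ) = s • (K * X * Kᴴ) + t • (K * Z * Kᴴ) - t • (W * Kᴴ) := by
    rw [h2]; abel
  rw [h5]
  abel

/-- The difference of the two sides is `‖s x + t y‖²`. -/
lemma weighted_sq_norm_ge {E : Type*} [NormedAddCommGroup E] [InnerProductSpace ℝ E] {s t : ℝ}
    (hst : s + t = 1) (x y : E) : s * t * ‖x - y‖ ^ 2 ≤ s * ‖x‖ ^ 2 + t * ‖y‖ ^ 2 := by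
  have h1 := norm_add_sq_real (s • x) (t • y)
  have h2 := norm_sub_sq_real x y
  rw [real_inner_smul_left, real_inner_smul_right, norm_smul, norm_smul, mul_pow, mul_pow,
    Real.norm_eq_abs, Real.norm_eq_abs, sq_abs, sq_abs] at h1
  have h3 := sq_nonneg ‖s • x + t • y‖
  obtain rfl : t = 1 - s := by linarith
  rw [h2]
  nlinarith

/-- Quantitative convexity of the cost in terms of the feedback gains `K = Y X(Y)⁻¹`. -/
lemma lqrCost_convex_comb_le (hA : IsUnit (lyapunovOp A)) {r δ : ℝ} (hr : 0 ≤ r)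
    (hrR : (R - r • 1).PosSemidef) {Y W : Matrix (Fin m) (Fin n) ℂ}
    (hY : (covarianceOf A B V Y).PosDef) (hW : (covarianceOf A B V W).PosDef)
    (hYδ : (covarianceOf A B V Y - δ • 1).PosSemidef)
    (hWδ : (covarianceOf A B V W - δ • 1).PosSemidef) (hδ : 0 ≤ δ) {s t : ℝ} (hs : 0 ≤ s)
    (ht : 0 ≤ t) (hst : s + t = 1) :
    lqrCost A B V Q R (s • Y + t • W) ≤ s * lqrCost A B V Q R Y + t * lqrCost A B V Q R W -
      r * δ * (s * t * ‖Y * (covarianceOf A B V Y)⁻¹ - W * (covarianceOf A B V W)⁻¹‖ ^ 2) := by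
  have hP : (s • covarianceOf A B V Y + t • covarianceOf A B V W).PosDef := by
    rw [← covarianceOf_convex_comb hst, ← mem_stabilizingSet_iff hA]
    exact convex_stabilizingSet hA ((mem_stabilizingSet_iff hA).mpr hY)
      ((mem_stabilizingSet_iff hA).mpr hW) hs ht hst
  rw [lqrCost_eq, lqrCost_eq, lqrCost_eq, covarianceOf_convex_comb hst]
  set X := covarianceOf A B V Y
  set Z := covarianceOf A B V W
  set K := (s • Y + t • W) * (s • X + t • Z)⁻¹ with hK
  have h1 := matrix_fractional_defect hY hW Y W hP hK
  set G := Y * X⁻¹ - K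
  set H := W * Z⁻¹ - K
  have hGH : Y * X⁻¹ - W * Z⁻¹ = G - H := by simp only [G, H]; abel
  have h2 := congrArg (fun M => (trace (R * M)).re) h1
  simp only [Matrix.mul_sub, Matrix.mul_add, Matrix.mul_smul, trace_sub, trace_add,
    Complex.sub_re, Complex.add_re, re_trace_real_smul] at h2
  have bound : ∀ (M : Matrix (Fin n) (Fin n) ℂ) (F : Matrix (Fin m) (Fin n) ℂ), M.PosSemidef →
      (M - δ • 1).PosSemidef → r * (δ * ‖F‖ ^ 2) ≤ (trace (R * (F * M * Fᴴ))).re := by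
    intro M F hM hMδ
    refine le_trans ?_ (mul_re_trace_le_re_trace_mul hrR (hM.mul_mul_conjTranspose_same F))
    have h3 := hMδ.re_quadratic_nonneg Fᴴ
    rw [re_quadratic_sub_smul_one, frobenius_norm_conjTranspose, conjTranspose_conjTranspose] at h3
    exact mul_le_mul_of_nonneg_left (by linarith) hr
  have h3 := mul_le_mul_of_nonneg_left (bound X G hY.posSemidef hYδ) hs
  have h4 := mul_le_mul_of_nonneg_left (bound Z H hW.posSemidef hWδ) ht
  have h5 := mul_le_mul_of_nonneg_left (weighted_sq_norm_ge hst G H) (mul_nonneg hr hδ)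
  simp only [Matrix.mul_add, Matrix.mul_smul, trace_add, Complex.add_re, re_trace_real_smul]
  rw [hGH]
  linarith

lemma convexOn_lqrCost (hA : IsUnit (lyapunovOp A)) (hR : R.PosDef) :
    ConvexOn ℝ (stabilizingSet A B V) (lqrCost A B V Q R) := by
  refine ⟨convex_stabilizingSet hA, fun Y hY W hW s t hs ht hst => ?_⟩
  -- With both margins zero only semidefiniteness is needed, which gives plain convexity on the
  -- whole domain.
  have h := lqrCost_convex_comb_le (Q := Q) (r := 0) (δ := 0) hA le_rfl
    (by simpa using hR.posSemidef) hY.2 hW.2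
    (by simpa using hY.2.posSemidef) (by simpa using hW.2.posSemidef) le_rfl hs ht hst
  simpa using h

/-- On a set with bounded covariances and gains, `Y` is a Lipschitz function of the gain. -/
lemma norm_sub_le_mul_norm_gain_sub (hA : IsUnit (lyapunovOp A)) {ε τ κ : ℝ}
    (hε : 0 < ε) (hτ0 : 0 ≤ τ) (hεV : (V - ε • 1).PosSemidef) {Y W : Matrix (Fin m) (Fin n) ℂ}
    (hY : (covarianceOf A B V Y).PosDef) (hW : (covarianceOf A B V W).PosDef)
    (hYτ : (trace (covarianceOf A B V Y)).re ≤ τ) (hWτ : (trace (covarianceOf A B V W)).re ≤ τ)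
    (hWκ : ‖W * (covarianceOf A B V W)⁻¹‖ ≤ κ) :
    ‖Y - W‖ ≤ (τ + κ * (2 * ‖B‖ * τ / ε * τ)) *
      ‖Y * (covarianceOf A B V Y)⁻¹ - W * (covarianceOf A B V W)⁻¹‖ := by
  have huX := (Matrix.isUnit_iff_isUnit_det _).mp hY.isUnit
  have huZ := (Matrix.isUnit_iff_isUnit_det _).mp hW.isUnit
  have hLX := lyapunovOp_covarianceOf (V := V) (B := B) hA Y
  have hLZ := lyapunovOp_covarianceOf (V := V) (B := B) hA W
  set X := covarianceOf A B V Y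
  set Z := covarianceOf A B V W
  set K := Y * X⁻¹
  set H := W * Z⁻¹
  have hKX : K * X = Y := Matrix.nonsing_inv_mul_cancel_right _ _ huX
  have hHZ : H * Z = W := Matrix.nonsing_inv_mul_cancel_right _ _ huZ
  have hXn : ‖X‖ ≤ τ := hY.posSemidef.norm_le_re_trace.trans hYτ
  have hcl : ∀ M : Matrix (Fin n) (Fin n) ℂ, M.IsHermitian →
      lyapunovOp (A - B * H) M = lyapunovOp A M - inputOp B (H * M) := by
    intro M hM
    simp only [lyapunovOp_apply, inputOp, conjTranspose_sub, conjTranspose_mul, hM.eq,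
      Matrix.sub_mul, Matrix.mul_sub, Matrix.mul_assoc]
    abel
  have hadd : ∀ M N : Matrix (Fin m) (Fin n) ℂ, inputOp B (M - N) = inputOp B M - inputOp B N :=
    map_sub (inputLinearMap B)
  -- `Z` solves the closed-loop equation of its own gain `H` with right-hand side `-V`, so it
  -- certifies `A - B H`.
  have hcert : (-lyapunovOp (A - B * H) Z - ε • 1).PosSemidef := by
    have h1 : -lyapunovOp (A - B * H) Z = V := by
      rw [hcl Z hW.1, hLZ, hHZ]; abel
    rwa [h1]
  -- Subtracting the two Lyapunov equations leaves a right-hand side linear in `K - H`, so `X - Z`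
  -- is controlled by the gain difference.
  have hdiff : lyapunovOp (A - B * H) (X - Z) = inputOp B ((K - H) * X) := by
    rw [hcl _ (hY.1.sub hW.1), map_sub, hLX, hLZ, Matrix.sub_mul, Matrix.mul_sub, hKX, hHZ, hadd,
      hadd]
    abel
  have h1 := norm_le_of_lyapunov_certificate hε hW hcert (hY.1.sub hW.1)
  have h2 : ‖(K - H) * X‖ ≤ ‖K - H‖ * τ := (frobenius_norm_mul _ _).trans (by gcongr)
  have h3 : ‖inputOp B ((K - H) * X)‖ ≤ 2 * ‖B‖ * τ * ‖K - H‖ := by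
    refine (norm_add_le _ _).trans ?_
    have h4 : ‖B * ((K - H) * X)‖ ≤ ‖B‖ * (‖K - H‖ * τ) :=
      (frobenius_norm_mul _ _).trans (by gcongr)
    rw [← conjTranspose_mul, frobenius_norm_conjTranspose]
    linarith
  rw [hdiff] at h1
  have h5 : ‖X - Z‖ ≤ 2 * ‖B‖ * τ * ‖K - H‖ / ε * τ :=
    h1.trans (mul_le_mul (by gcongr) hWτ hW.posSemidef.re_trace_nonneg (by positivity))
  have h6 : Y - W = (K - H) * X + H * (X - Z) := by
    rw [Matrix.sub_mul, Matrix.mul_sub, hKX, hHZ]; abel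
  have hκ : 0 ≤ κ := (norm_nonneg _).trans hWκ
  calc ‖Y - W‖ ≤ ‖(K - H) * X‖ + ‖H * (X - Z)‖ := h6 ▸ norm_add_le _ _
    _ ≤ ‖K - H‖ * τ + κ * (2 * ‖B‖ * τ * ‖K - H‖ / ε * τ) := by
      refine add_le_add h2 ((frobenius_norm_mul _ _).trans ?_)
      gcongr
    _ = _ := by ring

lemma exists_strongConvexOn_lqrCost (hA : IsUnit (lyapunovOp A)) (hV : V.PosDef) (hQ : Q.PosDef)
    (hR : R.PosDef) (a : ℝ) : ∃ μ : ℝ, 0 < μ ∧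
      StrongConvexOn (sublevelSet (stabilizingSet A B V) (lqrCost A B V Q R) a) μ
        (lqrCost A B V Q R) := by
  obtain ⟨δ, τ, α, hδ, hτ, hα, h⟩ := exists_sublevel_bounds (B := B) hA hV hQ hR a
  obtain ⟨ε, hε, hεV⟩ := hV.exists_sub_smul_one_posSemidef
  obtain ⟨r, hr, hrR⟩ := hR.exists_sub_smul_one_posSemidef
  set c := τ + √(α / δ) * (2 * ‖B‖ * τ / ε * τ) + 1
  have hc : 0 < c := by positivity
  -- The factor 2 offsets the `μ / 2` in `StrongConvexOn`; the `+ 1` in `c` keeps the denominator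
  -- positive.
  refine ⟨2 * (r * δ / c ^ 2), by positivity, (convexOn_lqrCost hA hR).convex_le a,
    fun Y hY W hW s t hs ht hst => ?_⟩
  obtain ⟨hYδ, hYτ, -⟩ := h Y hY
  obtain ⟨hWδ, hWτ, hWα⟩ := h W hW
  have hWκ : ‖W * (covarianceOf A B V W)⁻¹‖ ≤ √(α / δ) := by
    refine Real.le_sqrt_of_sq_le ?_
    rw [le_div_iff₀ hδ, mul_comm]
    exact (sq_norm_mul_inv_le hW.1.2 hWδ W).trans hWα
  have h1 := norm_sub_le_mul_norm_gain_sub hA hε hτ hεV hY.1.2 hW.1.2 hYτ hWτ hWκ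
  have h2 := lqrCost_convex_comb_le (Q := Q) hA hr.le hrR hY.1.2 hW.1.2 hYδ hWδ hδ.le hs ht hst
  set d := ‖Y * (covarianceOf A B V Y)⁻¹ - W * (covarianceOf A B V W)⁻¹‖
  have h3 : ‖Y - W‖ ≤ c * d := h1.trans
    (mul_le_mul_of_nonneg_right (le_add_of_nonneg_right zero_le_one) (norm_nonneg _))
  have h4 : ‖Y - W‖ ^ 2 / c ^ 2 ≤ d ^ 2 := by
    rw [div_le_iff₀ (by positivity), ← mul_pow, mul_comm d]
    gcongr
  have h5 := mul_le_mul_of_nonneg_left h4 (by positivity : 0 ≤ r * δ * (s * t))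
  simp only [smul_eq_mul]
  have h6 : s * t * (2 * (r * δ / c ^ 2) / 2 * ‖Y - W‖ ^ 2) =
      r * δ * (s * t) * (‖Y - W‖ ^ 2 / c ^ 2) := by ring
  rw [h6]
  linarith

end Convexity

/-! ### The main theorem -/

theorem proposition2 (n m : ℕ)
    (A : Matrix (Fin n) (Fin n) ℂ) (B : Matrix (Fin n) (Fin m) ℂ)
    (V Q : Matrix (Fin n) (Fin n) ℂ) (R : Matrix (Fin m) (Fin m) ℂ)
    (hAB : IsControllable A B) (hV : V.PosDef) (hQ : Q.PosDef) (hR : R.PosDef)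
    (hA : IsUnit (lyapunovOp A)) :
    (∀ Y ∈ stabilizingSet A B V, (lqrTrace A B V Q R Y).im = 0) ∧
      SublevelRegular (stabilizingSet A B V) (lqrCost A B V Q R) := by
  refine ⟨fun Y hY => lqrTrace_im hQ.1 hR.1 hY.2, ?_⟩
  have hconv := convexOn_lqrCost (B := B) (V := V) (Q := Q) hA hR
  have hsmooth : ∀ a, ∀ Y ∈ sublevelSet (stabilizingSet A B V) (lqrCost A B V Q R) a,
      ContDiffAt ℝ 2 (lqrCost A B V Q R) Y := fun a Y hY => contDiffAt_lqrCost hY.1.2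
  exact
    { isOpen_domain := isOpen_stabilizingSet hA hV.1
      convex_domain := convex_stabilizingSet hA
      proper := stabilizingSet_nonempty hAB hV hA
      closed := isClosed_epigraph_lqrCost hA hV hQ hR
      convex := hconv
      compact_sublevel := isCompact_sublevelSet hA hV hQ hR
      lipschitz_gradient := fun a =>
        ⟨fun Y hY => (hsmooth a Y hY).differentiableAt (by norm_num),
          exists_lipschitzOnWith_gradient (isCompact_sublevelSet hA hV hQ hR a)
            (hconv.convex_le a) (hsmooth a)⟩
      strong_convexity := exists_strongConvexOn_lqrCost hA hV hQ hR }
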